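/- **Theorem 1.1 (Semiclassical Moser–Trudinger inequality).** Let $\Omega\subset\mathbb{R}^2$ be open and bounded, with Lebesgue measure $|\Omega|$, and let $H_0^1(\Omega)$ be the closure of $C_c^\infty(\Omega)$ (complex-valued functions) in the $H^1(\Omega)$ norm. Let $N\ge 1$ be an integer and let $u_1,\dots,u_N\in H_0^1(\Omega)$ have $L^2$-orthonormal weak gradients, that is, $$\int_\Omega \overline{\nabla u_n(x)}\cdot\nabla u_m(x)\,dx=\delta_{nm}\qquad\text{for all } 1\le n,m\le N .$$ Put $\rho(x)=\sum_{n=1}^N|u_n(x)|^2$. Then for every $\varepsilon\in(0,1/4]$, $$\frac1{|\Omega|}\int_\Omega \exp\bigl(4\pi(1-\varepsilon)\rho(x)\bigr)\,dx\;\le\;\frac{e^{8}}{\varepsilon^{4}}\,N .$$ Consequently, for every $\alpha>0$ such that $N\ge\max\{e^4,\,e^{\frac{\alpha}{4\pi}+1}\}$, $$\frac1{|\Omega|}\int_\Omega \exp\Bigl(\alpha\,\frac{\rho(x)}{\ln N}\Bigr)\,dx\;\le\;\exp\Bigl(\frac{\alpha}{4\pi}\Bigl[1+\frac{14\,\ln(\ln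 N)}{\ln N}\Bigr]\Bigr).$$ In particular, both integrals are finite. -/

import Mathlib

open MeasureTheory Filter Topology
open scoped ContDiff ENNReal

noncomputable section

/-- The Euclidean plane `ℝ²`. -/
abbrev Plane : Type := EuclideanSpace ℝ (Fin 2)

/-- Complex vectors with two components, with the Hermitian inner product
`⟪v, w⟫ = ∑ i, conj (v i) * w i`. -/
abbrev CVec : Type := EuclideanSpace ℂ (Fin 2)

/-- `φ ∈ C_c^∞(Ω)`, complex valued. -/
structure IsTestFunction (Ω : Set Plane) (φ : Plane → ℂ) : Prop where
  smooth : ContDiff ℝ ∞ φ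
  compact_support : HasCompactSupport φ
  support_subset : tsupport φ ⊆ Ω

/-- The classical partial derivative `∂_i φ`. -/
def partialDeriv (i : Fin 2) (φ : Plane → ℂ) (x : Plane) : ℂ :=
  fderiv ℝ φ x (EuclideanSpace.single i 1)

/-- The classical gradient `∇φ = (∂_1 φ, ∂_2 φ)`. -/
def classicalGradient (φ : Plane → ℂ) (x : Plane) : CVec :=
  WithLp.toLp 2 fun i => partialDeriv i φ x

/-- `g` is the weak (distributional) gradient of `u` on `Ω`: both are locally integrable on `Ω`
and `∫_Ω u ∂_i φ = - ∫_Ω g_i φ` for all test functions `φ` and `i = 1, 2`.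
Such a `g` is unique almost everywhere on `Ω` when `Ω` is open. -/
structure IsWeakGradient (Ω : Set Plane) (u : Plane → ℂ) (g : Plane → CVec) : Prop where
  locallyIntegrableOn : LocallyIntegrableOn u Ω
  locallyIntegrableOn_grad : LocallyIntegrableOn g Ω
  integral_eq : ∀ φ : Plane → ℂ, IsTestFunction Ω φ → ∀ i : Fin 2,
    ∫ x in Ω, u x * partialDeriv i φ x = - ∫ x in Ω, g x i * φ x

/-- `u ∈ H_0^1(Ω)`: the function `u` is in `L²(Ω)`, has a weak gradient in `L²(Ω)`, and is the
limit in the `H^1(Ω)` norm of a sequence of test functions. Functions are defined on the whole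
plane, but only their values on `Ω` matter. -/
def MemH01 (Ω : Set Plane) (u : Plane → ℂ) : Prop :=
  MemLp u 2 (volume.restrict Ω) ∧
  ∃ g : Plane → CVec, IsWeakGradient Ω u g ∧ MemLp g 2 (volume.restrict Ω) ∧
    ∃ φ : ℕ → Plane → ℂ, (∀ k, IsTestFunction Ω (φ k)) ∧
      Tendsto (fun k => eLpNorm (fun x => φ k x - u x) 2 (volume.restrict Ω)) atTop (𝓝 0) ∧
      Tendsto (fun k => eLpNorm (fun x => classicalGradient (φ k) x - g x) 2
        (volume.restrict Ω)) atTop (𝓝 0)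

/-- The one-body density `ρ(x) = ∑ n, |u_n(x)|²`. -/
def density {N : ℕ} (u : Fin N → Plane → ℂ) (x : Plane) : ℝ :=
  ∑ n, ‖u n x‖ ^ 2

end

/-! Split each `u n` at a length scale `r` into a mollified part and a remainder. The mollifier
`p_r` is the divergence of the explicit field `k_r(z) = z / (2π(|z|² + r²))`, so the mollification
of `u` at `x` is the `L²` pairing of the gradient with `k_r(x - ·)`.

Since the gradients are orthonormal, Bessel bounds the sum of squares of the mollified parts,
uniformly in `x` and with no factor `N`, by `∫_Ω |k_r(x - y)|² dy ≤ (log(1 + |Ω|/(πr²)) + 1)/(4π)`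
(`sum_norm_regularize_sq_le`, `integral_norm_gradKernel_sq_le`). Each remainder has `L²` norm at
most the first moment `πr/2` of `p_r` (`MemH01.eLpNorm_sub_regularize_le`); only here does `N`
enter, linearly.

Choose `r` so that the mollified part alone cannot bring `4πρ` up to `a`. On `{4πρ ≥ a}` the
remainders are then bounded below, and Markov's inequality gives measure at most a constant times `N
|Ω| (a + 1) e^{-a}` (`measure_density_ge_le`). Summing over integer levels gives the subcritical
bound, of order `ε⁻²`. The second bound follows with `ε = 1 / log N` and Jensen's inequality. -/

noncomputable section

/-! ### The mollifier: total mass and first moment. -/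

/-- The rotationally invariant probability density `r² / (π (|z|² + r²)²)` on the plane. -/
def mollifier (r : ℝ) (z : Plane) : ℝ := r ^ 2 / (Real.pi * (‖z‖ ^ 2 + r ^ 2) ^ 2)

/-- The vector field `z / (2π (|z|² + r²))`, whose divergence is `mollifier r`, at `z = x - y`. -/
def gradKernel (r : ℝ) (x y : Plane) : CVec :=
  WithLp.toLp 2 fun i => (((x i - y i) / (2 * Real.pi * (‖x - y‖ ^ 2 + r ^ 2)) : ℝ) : ℂ)

lemma volume_real_unit_ball_plane : (volume : Measure Plane).real (Metric.ball 0 1) = Real.pi := by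
  simp [Measure.real, EuclideanSpace.volume_ball_fin_two, Real.pi_pos.le]

lemma integral_radial_plane (f : ℝ → ℝ) :
    ∫ z : Plane, f ‖z‖ = 2 * Real.pi * ∫ s in Set.Ioi (0 : ℝ), s * f s := by
  rw [integral_fun_norm_addHaar, volume_real_unit_ball_plane]
  simp [mul_assoc]

lemma integrable_radial_plane {f : ℝ → ℝ}
    (hf : IntegrableOn (fun s => s * f s) (Set.Ioi 0)) : Integrable fun z : Plane => f ‖z‖ := by
  rw [integrable_fun_norm_addHaar]
  simpa using hf

lemma hasDerivAt_radial_mass {r : ℝ} (hr : 0 < r) (s : ℝ) :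
    HasDerivAt (fun s => - (r ^ 2 / (2 * Real.pi * (s ^ 2 + r ^ 2))))
      (s * (r ^ 2 / (Real.pi * (s ^ 2 + r ^ 2) ^ 2))) s := by
  have h0 : s ^ 2 + r ^ 2 ≠ 0 := by positivity
  have h1 : HasDerivAt (fun s : ℝ => 2 * Real.pi * (s ^ 2 + r ^ 2)) (2 * Real.pi * (2 * s)) s := by
    simpa using (((hasDerivAt_id s).pow 2).add_const (r ^ 2)).const_mul (2 * Real.pi)
  have h2 := ((hasDerivAt_const s (r ^ 2)).div h1 (by positivity)).neg
  refine h2.congr_deriv ?_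
  field_simp
  ring

lemma tendsto_radial_mass (r : ℝ) :
    Tendsto (fun s : ℝ => - (r ^ 2 / (2 * Real.pi * (s ^ 2 + r ^ 2)))) atTop (𝓝 0) := by
  have h : Tendsto (fun s : ℝ => 2 * Real.pi * (s ^ 2 + r ^ 2)) atTop atTop :=
    (tendsto_atTop_add_const_right _ _ (tendsto_pow_atTop two_ne_zero)).const_mul_atTop
      (by positivity)
  simpa using (h.const_div_atTop (r ^ 2)).neg

lemma integrable_mollifier {r : ℝ} (hr : 0 < r) : Integrable (mollifier r) :=
  integrable_radial_plane (f := fun s => r ^ 2 / (Real.pi * (s ^ 2 + r ^ 2) ^ 2)) <|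
    integrableOn_Ioi_deriv_of_nonneg' (fun s _ => hasDerivAt_radial_mass hr s)
      (fun s hs => by have := (Set.mem_Ioi.1 hs).le; positivity) (tendsto_radial_mass r)

lemma integral_mollifier {r : ℝ} (hr : 0 < r) : ∫ z, mollifier r z = 1 := by
  unfold mollifier
  rw [integral_radial_plane (fun s => r ^ 2 / (Real.pi * (s ^ 2 + r ^ 2) ^ 2)),
    integral_Ioi_of_hasDerivAt_of_nonneg' (fun s _ => hasDerivAt_radial_mass hr s)
      (fun s hs => by have := (Set.mem_Ioi.1 hs).le; positivity) (tendsto_radial_mass r)]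
  field_simp
  simp

lemma mollifier_nonneg (r : ℝ) (z : Plane) : 0 ≤ mollifier r z := by
  unfold mollifier; positivity

lemma continuous_mollifier {r : ℝ} (hr : 0 < r) : Continuous (mollifier r) := by
  unfold mollifier
  refine continuous_const.div (by fun_prop) fun z => by positivity

/-- This primitive vanishes at `0` and tends to `r / 4` at infinity, so the factor `2π` of polar
coordinates makes the first moment `πr / 2`. -/
lemma hasDerivAt_radial_moment {r : ℝ} (hr : 0 < r) (s : ℝ) :
    HasDerivAt (fun s => (r * Real.arctan (s / r) - r ^ 2 * s / (s ^ 2 + r ^ 2)) / (2 * Real.pi))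
      (s * (s * (r ^ 2 / (Real.pi * (s ^ 2 + r ^ 2) ^ 2)))) s := by
  have h0 : s ^ 2 + r ^ 2 ≠ 0 := by positivity
  have h1 : HasDerivAt (fun s : ℝ => s ^ 2 + r ^ 2) (2 * s) s := by
    simpa using ((hasDerivAt_id s).pow 2).add_const (r ^ 2)
  have h3 : HasDerivAt (fun s : ℝ => s / r) (1 / r) s := (hasDerivAt_id s).div_const r
  have h4 : HasDerivAt (fun s : ℝ => r ^ 2 * s) (r ^ 2) s := by
    simpa using (hasDerivAt_id s).const_mul (r ^ 2)
  have h2 := (((h3.arctan).const_mul r).sub (h4.div h1 h0)).div_const (2 * Real.pi)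
  refine h2.congr_deriv ?_
  have : (1 + (s / r) ^ 2) = (s ^ 2 + r ^ 2) / r ^ 2 := by field_simp; ring
  rw [this]
  field_simp
  ring

lemma tendsto_radial_moment {r : ℝ} (hr : 0 < r) :
    Tendsto (fun s => (r * Real.arctan (s / r) - r ^ 2 * s / (s ^ 2 + r ^ 2)) / (2 * Real.pi))
      atTop (𝓝 (r / 4)) := by
  have h1 : Tendsto (fun s => Real.arctan (s / r)) atTop (𝓝 (Real.pi / 2)) :=
    (Real.tendsto_arctan_atTop.mono_right nhdsWithin_le_nhds).comp
      (tendsto_id.atTop_div_const hr)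
  have h2 : Tendsto (fun s : ℝ => r ^ 2 * s / (s ^ 2 + r ^ 2)) atTop (𝓝 0) := by
    have h : Tendsto (fun s : ℝ => r ^ 2 / s) atTop (𝓝 0) := tendsto_id.const_div_atTop _
    refine squeeze_zero' (eventually_atTop.2 ⟨0, fun s hs => by positivity⟩) ?_ h
    filter_upwards [eventually_gt_atTop 0] with s hs
    rw [div_le_div_iff₀ (by positivity) hs]
    nlinarith [sq_nonneg (r ^ 2)]
  have h3 := (((h1.const_mul r).sub h2).div_const (2 * Real.pi))
  convert h3 using 2
  field_simp
  ring

lemma integrable_norm_mul_mollifier {r : ℝ} (hr : 0 < r) :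
    Integrable fun z => ‖z‖ * mollifier r z :=
  integrable_radial_plane (f := fun s => s * (r ^ 2 / (Real.pi * (s ^ 2 + r ^ 2) ^ 2))) <|
    integrableOn_Ioi_deriv_of_nonneg' (fun s _ => hasDerivAt_radial_moment hr s)
      (fun s hs => by have := (Set.mem_Ioi.1 hs).le; positivity) (tendsto_radial_moment hr)

lemma integral_norm_mul_mollifier {r : ℝ} (hr : 0 < r) :
    ∫ z, ‖z‖ * mollifier r z = Real.pi * r / 2 := by
  unfold mollifier
  rw [integral_radial_plane (fun s => s * (r ^ 2 / (Real.pi * (s ^ 2 + r ^ 2) ^ 2))),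
    integral_Ioi_of_hasDerivAt_of_nonneg' (fun s _ => hasDerivAt_radial_moment hr s)
      (fun s hs => by have := (Set.mem_Ioi.1 hs).le; positivity) (tendsto_radial_moment hr)]
  simp
  ring

/-! ### Pointwise and `L²` bounds for the kernel. -/

lemma norm_gradKernel_sq (r : ℝ) (x y : Plane) :
    ‖gradKernel r x y‖ ^ 2 = ‖x - y‖ ^ 2 / (2 * Real.pi * (‖x - y‖ ^ 2 + r ^ 2)) ^ 2 := by
  rw [EuclideanSpace.norm_sq_eq]
  conv_rhs => rw [EuclideanSpace.norm_sq_eq (x - y)]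
  simp only [gradKernel, Complex.norm_real, Real.norm_eq_abs, sq_abs, div_pow, PiLp.sub_apply,
    ← Finset.sum_div]
  rw [EuclideanSpace.norm_sq_eq]
  simp

lemma norm_gradKernel_sq_le {r : ℝ} (hr : 0 < r) (x y : Plane) :
    ‖gradKernel r x y‖ ^ 2 ≤ (1 / (4 * Real.pi ^ 2)) * (1 / (‖y - x‖ ^ 2 + r ^ 2)) := by
  rw [norm_gradKernel_sq, norm_sub_rev, div_mul_div_comm, div_le_div_iff₀ (by positivity)
    (by positivity)]
  have := Real.pi_pos
  have h : 0 ≤ Real.pi ^ 2 * (r ^ 2 * (‖y - x‖ ^ 2 + r ^ 2)) := by positivity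
  nlinarith

lemma continuous_gradKernel {r : ℝ} (hr : 0 < r) :
    Continuous fun q : Plane × Plane => gradKernel r q.1 q.2 := by
  unfold gradKernel
  refine (PiLp.continuous_toLp 2 _).comp (continuous_pi fun i => Complex.continuous_ofReal.comp ?_)
  refine Continuous.div (by fun_prop) (by fun_prop) fun q => by positivity

lemma integral_ball_inv_sq_add_sq {r R : ℝ} (hr : 0 < r) (hR : 0 ≤ R) (x : Plane) :
    ∫ y in Metric.ball x R, 1 / (‖y - x‖ ^ 2 + r ^ 2) = Real.pi * Real.log (1 + R ^ 2 / r ^ 2) := by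
  have h1 : ∫ y in Metric.ball x R, 1 / (‖y - x‖ ^ 2 + r ^ 2)
      = ∫ z : Plane, (Set.Iio R).indicator (fun s => 1 / (s ^ 2 + r ^ 2)) ‖z‖ := by
    rw [← integral_indicator Metric.isOpen_ball.measurableSet,
      ← integral_sub_right_eq_self
        (fun z : Plane => (Set.Iio R).indicator (fun s => 1 / (s ^ 2 + r ^ 2)) ‖z‖) x]
    simp [Set.indicator, dist_eq_norm]
  have h2 : ∀ s, s * (Set.Iio R).indicator (fun s => 1 / (s ^ 2 + r ^ 2)) s
      = (Set.Iio R).indicator (fun s => s / (s ^ 2 + r ^ 2)) s := by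
    intro s
    by_cases h : s < R <;> simp [h, div_eq_mul_inv]
  rw [h1, integral_radial_plane]
  simp_rw [h2]
  rw [setIntegral_indicator measurableSet_Iio, Set.Ioi_inter_Iio, ← integral_Ioc_eq_integral_Ioo,
    ← intervalIntegral.integral_of_le hR]
  have h3 : ∀ s ∈ Set.uIcc 0 R,
      HasDerivAt (fun s => Real.log (s ^ 2 + r ^ 2) / 2) (s / (s ^ 2 + r ^ 2)) s := by
    intro s _
    have h0 : s ^ 2 + r ^ 2 ≠ 0 := by positivity
    have h1 : HasDerivAt (fun s : ℝ => s ^ 2 + r ^ 2) (2 * s) s := by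
      simpa using ((hasDerivAt_id s).pow 2).add_const (r ^ 2)
    refine ((h1.log h0).div_const 2).congr_deriv ?_
    field_simp
  rw [intervalIntegral.integral_eq_sub_of_hasDerivAt h3]
  · have : 1 + R ^ 2 / r ^ 2 = (R ^ 2 + r ^ 2) / r ^ 2 := by field_simp; ring
    rw [this, Real.log_div (by positivity) (by positivity)]
    simp
    ring
  · refine Continuous.intervalIntegrable ?_ _ _
    exact continuous_id.div (by fun_prop) fun s => by positivity

lemma continuous_inv_sq_add_sq {r : ℝ} (hr : 0 < r) (x : Plane) :
    Continuous fun y : Plane => 1 / (‖y - x‖ ^ 2 + r ^ 2) :=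
  continuous_const.div (by fun_prop) fun y => by positivity

lemma integrableOn_inv_sq_add_sq {r : ℝ} (hr : 0 < r) (x : Plane) {S : Set Plane}
    (hS : volume S ≠ ⊤) : IntegrableOn (fun y : Plane => 1 / (‖y - x‖ ^ 2 + r ^ 2)) S := by
  refine Measure.integrableOn_of_bounded (M := 1 / r ^ 2) hS
    (continuous_inv_sq_add_sq hr x).aestronglyMeasurable (ae_of_all _ fun y => ?_)
  rw [Real.norm_of_nonneg (by positivity)]
  exact one_div_le_one_div_of_le (by positivity) (by nlinarith [sq_nonneg ‖y - x‖])

/-- Compare `S` with the disc about `x` of the same area. Inside the disc the integral is explicit;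
outside, the integrand is at most `1 / (R² + r²)` on a set of area at most `πR²`, which costs at
most `π`. This replaces a rearrangement inequality at the price of the `+ 1`. -/
lemma integral_inv_sq_add_sq_le {r : ℝ} (hr : 0 < r) (x : Plane) {S : Set Plane}
    (hS : MeasurableSet S) (hfin : volume S ≠ ⊤) :
    ∫ y in S, 1 / (‖y - x‖ ^ 2 + r ^ 2)
      ≤ Real.pi * (Real.log (1 + volume.real S / (Real.pi * r ^ 2)) + 1) := by
  set R := Real.sqrt (volume.real S / Real.pi) with hRdef
  have hR : R ^ 2 = volume.real S / Real.pi := Real.sq_sqrt (by positivity)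
  have hball : volume (Metric.ball x R) ≠ ⊤ := measure_ball_lt_top.ne
  have hint := integrableOn_inv_sq_add_sq hr x hfin
  rw [← integral_inter_add_sdiff Metric.isOpen_ball.measurableSet hint (t := Metric.ball x R)]
  have h1 : ∫ y in S ∩ Metric.ball x R, 1 / (‖y - x‖ ^ 2 + r ^ 2)
      ≤ Real.pi * Real.log (1 + R ^ 2 / r ^ 2) := by
    rw [← integral_ball_inv_sq_add_sq hr (Real.sqrt_nonneg _) x]
    exact setIntegral_mono_set (integrableOn_inv_sq_add_sq hr x hball)
      (ae_of_all _ fun y => by positivity) (ae_of_all _ Set.inter_subset_right)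
  have h2 : ∫ y in S \ Metric.ball x R, 1 / (‖y - x‖ ^ 2 + r ^ 2)
      ≤ ∫ _ in S \ Metric.ball x R, 1 / (R ^ 2 + r ^ 2) := by
    refine setIntegral_mono_on (hint.mono_set Set.sdiff_subset)
      (integrableOn_const (measure_ne_top_of_subset Set.sdiff_subset hfin))
      (hS.diff Metric.isOpen_ball.measurableSet) fun y hy => ?_
    have : R ≤ ‖y - x‖ := by simpa [dist_eq_norm] using hy.2
    have h0 : 0 ≤ R := Real.sqrt_nonneg _
    gcongr
  have h3 : ∫ _ in S \ Metric.ball x R, 1 / (R ^ 2 + r ^ 2) ≤ Real.pi := by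
    rw [setIntegral_const, smul_eq_mul, mul_one_div, div_le_iff₀ (by positivity)]
    have : volume.real (S \ Metric.ball x R) ≤ volume.real S :=
      measureReal_mono Set.sdiff_subset hfin
    have h4 : Real.pi * R ^ 2 = volume.real S := by rw [hR]; field_simp
    have := Real.pi_pos
    nlinarith [mul_pos this (pow_pos hr 2)]
  have h5 : R ^ 2 / r ^ 2 = volume.real S / (Real.pi * r ^ 2) := by rw [hR]; field_simp
  rw [← h5]
  linarith

lemma integral_norm_gradKernel_sq_le {r : ℝ} (hr : 0 < r) (x : Plane) {S : Set Plane}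
    (hS : MeasurableSet S) (hfin : volume S ≠ ⊤) :
    ∫ y in S, ‖gradKernel r x y‖ ^ 2
      ≤ (Real.log (1 + volume.real S / (Real.pi * r ^ 2)) + 1) / (4 * Real.pi) := by
  calc ∫ y in S, ‖gradKernel r x y‖ ^ 2
      ≤ ∫ y in S, (1 / (4 * Real.pi ^ 2)) * (1 / (‖y - x‖ ^ 2 + r ^ 2)) :=
        integral_mono_of_nonneg (ae_of_all _ fun y => by positivity)
          ((integrableOn_inv_sq_add_sq hr x hfin).const_mul _)
          (ae_of_all _ fun y => norm_gradKernel_sq_le hr x y)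
    _ ≤ (1 / (4 * Real.pi ^ 2)) *
        (Real.pi * (Real.log (1 + volume.real S / (Real.pi * r ^ 2)) + 1)) := by
        rw [integral_const_mul]
        exact mul_le_mul_of_nonneg_left (integral_inv_sq_add_sq_le hr x hS hfin) (by positivity)
    _ = _ := by field_simp

lemma norm_gradKernel_le {r : ℝ} (hr : 0 < r) (x y : Plane) :
    ‖gradKernel r x y‖ ≤ 1 / (2 * Real.pi * r) := by
  have hpi := Real.pi_pos
  have hb : 0 ≤ 1 / (2 * Real.pi * r) := by positivity
  refine le_of_sq_le_sq ?_ hb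
  refine (norm_gradKernel_sq_le hr x y).trans ?_
  rw [div_mul_div_comm, div_pow, div_le_div_iff₀ (by positivity) (by positivity)]
  nlinarith [mul_nonneg (sq_nonneg Real.pi) (sq_nonneg ‖y - x‖)]

lemma memLp_gradKernel {r : ℝ} (hr : 0 < r) (x : Plane) {S : Set Plane} (hfin : volume S ≠ ⊤) :
    MemLp (gradKernel r x) 2 (volume.restrict S) := by
  have : IsFiniteMeasure (volume.restrict S) := ⟨by simpa using hfin.lt_top⟩
  exact MemLp.of_bound ((continuous_gradKernel hr).comp
    (Continuous.prodMk_right x)).aestronglyMeasurable _ (ae_of_all _ (norm_gradKernel_le hr x))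

/-! ### Divergence of the kernel and integration by parts. -/

lemma hasDerivAt_line_gradKernel {r : ℝ} (hr : 0 < r) (x y : Plane) (i : Fin 2) :
    HasDerivAt (fun t : ℝ => gradKernel r x (y + t • EuclideanSpace.single i 1) i)
      (((-(2 * Real.pi * (‖x - y‖ ^ 2 + r ^ 2)) + 4 * Real.pi * (x i - y i) ^ 2) /
        (2 * Real.pi * (‖x - y‖ ^ 2 + r ^ 2)) ^ 2 : ℝ) : ℂ) 0 := by
  have hn : ∀ t : ℝ, ‖x - (y + t • EuclideanSpace.single i (1 : ℝ))‖ ^ 2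
      = ‖x - y‖ ^ 2 - 2 * t * (x i - y i) + t ^ 2 := by
    intro t
    rw [← sub_sub, norm_sub_sq_real, real_inner_smul_right, EuclideanSpace.inner_single_right,
      norm_smul]
    simp
    ring
  have hk : ∀ t : ℝ, gradKernel r x (y + t • EuclideanSpace.single i 1) i
      = (((x i - y i - t) / (2 * Real.pi * (‖x - y‖ ^ 2 - 2 * t * (x i - y i) + t ^ 2 + r ^ 2)) :
        ℝ) : ℂ) := by
    intro t
    simp only [gradKernel, hn]
    simp [sub_sub]
  simp_rw [hk]
  refine HasDerivAt.ofReal_comp ?_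
  have h1 : HasDerivAt (fun t : ℝ => x i - y i - t) (-1) 0 :=
    (hasDerivAt_id (0 : ℝ)).const_sub _
  have h2 : HasDerivAt (fun t : ℝ => 2 * Real.pi *
      (‖x - y‖ ^ 2 - 2 * t * (x i - y i) + t ^ 2 + r ^ 2))
      (2 * Real.pi * (-(2 * (x i - y i)))) 0 := by
    have h3 : HasDerivAt (fun t : ℝ => 2 * t * (x i - y i)) (2 * (x i - y i)) 0 := by
      simpa using ((hasDerivAt_id (0 : ℝ)).const_mul 2).mul_const (x i - y i)
    have h4 : HasDerivAt (fun t : ℝ => t ^ 2) 0 0 := by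
      simpa using hasDerivAt_pow 2 (0 : ℝ)
    simpa using (((h3.const_sub (‖x - y‖ ^ 2)).add h4).add_const (r ^ 2)).const_mul (2 * Real.pi)
  refine (h1.div h2 (by simp; positivity)).congr_deriv ?_
  simp
  ring

lemma differentiable_gradKernel {r : ℝ} (hr : 0 < r) (x : Plane) (i : Fin 2) :
    Differentiable ℝ fun y => gradKernel r x y i := by
  have h1 : Differentiable ℝ fun y : Plane => x i - y i := by fun_prop
  have h2 : Differentiable ℝ fun y : Plane => 2 * Real.pi * (‖x - y‖ ^ 2 + r ^ 2) :=
    (((differentiable_id.const_sub x).norm_sq ℝ).add_const _).const_mul _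
  have h3 : ∀ y, 2 * Real.pi * (‖x - y‖ ^ 2 + r ^ 2) ≠ 0 := fun y => by positivity
  have h4 : Differentiable ℝ fun y : Plane =>
      (x i - y i) / (2 * Real.pi * (‖x - y‖ ^ 2 + r ^ 2)) := by
    simp_rw [div_eq_mul_inv]
    exact h1.mul (h2.inv h3)
  exact Complex.ofRealCLM.differentiable.comp h4

lemma partialDeriv_gradKernel {r : ℝ} (hr : 0 < r) (x y : Plane) (i : Fin 2) :
    partialDeriv i (fun y => gradKernel r x y i) y =
      (((-(2 * Real.pi * (‖x - y‖ ^ 2 + r ^ 2)) + 4 * Real.pi * (x i - y i) ^ 2) /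
        (2 * Real.pi * (‖x - y‖ ^ 2 + r ^ 2)) ^ 2 : ℝ) : ℂ) := by
  rw [partialDeriv, ← (differentiable_gradKernel hr x i y).lineDeriv_eq_fderiv]
  exact (hasDerivAt_line_gradKernel hr x y i).deriv

lemma continuous_partialDeriv_gradKernel {r : ℝ} (hr : 0 < r) (x : Plane) (i : Fin 2) :
    Continuous (partialDeriv i fun y => gradKernel r x y i) := by
  simp_rw [funext fun y => partialDeriv_gradKernel hr x y i]
  refine Complex.continuous_ofReal.comp ?_
  refine Continuous.div (by fun_prop) (by fun_prop) fun y => by positivity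

/-- The minus sign comes from differentiating in `y` a field that depends on `x - y`; integration by
parts cancels it. -/
lemma sum_partialDeriv_gradKernel {r : ℝ} (hr : 0 < r) (x y : Plane) :
    ∑ i, partialDeriv i (fun y => gradKernel r x y i) y = -(mollifier r (x - y) : ℂ) := by
  simp_rw [partialDeriv_gradKernel hr]
  rw [← Complex.ofReal_sum, ← Complex.ofReal_neg]
  congr 1
  have h : ‖x - y‖ ^ 2 = (x 0 - y 0) ^ 2 + (x 1 - y 1) ^ 2 := by
    simp [EuclideanSpace.norm_sq_eq]
  have h0 : ‖x - y‖ ^ 2 + r ^ 2 ≠ 0 := by positivity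
  rw [Fin.sum_univ_two, mollifier, ← add_div]
  field_simp
  rw [h]
  ring

lemma IsTestFunction.continuous_partialDeriv {Ω : Set Plane} {φ : Plane → ℂ}
    (hφ : IsTestFunction Ω φ) (i : Fin 2) : Continuous (partialDeriv i φ) :=
  (hφ.smooth.continuous_fderiv (by simp)).clm_apply continuous_const

lemma IsTestFunction.hasCompactSupport_partialDeriv {Ω : Set Plane} {φ : Plane → ℂ}
    (hφ : IsTestFunction Ω φ) (i : Fin 2) : HasCompactSupport (partialDeriv i φ) :=
  hφ.compact_support.fderiv_apply ℝ _

lemma IsTestFunction.differentiable {Ω : Set Plane} {φ : Plane → ℂ}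
    (hφ : IsTestFunction Ω φ) : Differentiable ℝ φ :=
  hφ.smooth.differentiable (by simp)

lemma IsTestFunction.continuous_classicalGradient {Ω : Set Plane} {φ : Plane → ℂ}
    (hφ : IsTestFunction Ω φ) : Continuous (classicalGradient φ) :=
  (PiLp.continuous_toLp 2 _).comp (continuous_pi fun i => hφ.continuous_partialDeriv i)

lemma continuous_gradKernel_apply {r : ℝ} (hr : 0 < r) (x : Plane) (i : Fin 2) :
    Continuous fun y => gradKernel r x y i := (differentiable_gradKernel hr x i).continuous

lemma integral_inner_gradKernel_classicalGradient {Ω : Set Plane} {φ : Plane → ℂ}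
    (hφ : IsTestFunction Ω φ) {r : ℝ} (hr : 0 < r) (x : Plane) :
    ∫ y, inner ℂ (gradKernel r x y) (classicalGradient φ y) =
      ∫ y, φ y * (mollifier r (x - y) : ℂ) := by
  have hinner : ∀ y, inner ℂ (gradKernel r x y) (classicalGradient φ y)
      = ∑ i, gradKernel r x y i * partialDeriv i φ y := by
    intro y
    simp only [PiLp.inner_apply, classicalGradient, gradKernel, RCLike.inner_apply,
      Complex.conj_ofReal, mul_comm]
  have hi1 : ∀ i, Integrable fun y => gradKernel r x y i * partialDeriv i φ y := fun i =>
    ((continuous_gradKernel_apply hr x i).mul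
      (hφ.continuous_partialDeriv i)).integrable_of_hasCompactSupport
      (hφ.hasCompactSupport_partialDeriv i).mul_left
  have hi2 : ∀ i, Integrable fun y => partialDeriv i (fun y => gradKernel r x y i) y * φ y :=
    fun i => ((continuous_partialDeriv_gradKernel hr x i).mul
      hφ.smooth.continuous).integrable_of_hasCompactSupport hφ.compact_support.mul_left
  have hi3 : ∀ i, Integrable fun y => gradKernel r x y i * φ y := fun i =>
    ((continuous_gradKernel_apply hr x i).mul
      hφ.smooth.continuous).integrable_of_hasCompactSupport hφ.compact_support.mul_left
  simp_rw [hinner]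
  rw [integral_finsetSum _ fun i _ => hi1 i]
  have hparts : ∀ i, ∫ y, gradKernel r x y i * partialDeriv i φ y
      = - ∫ y, partialDeriv i (fun y => gradKernel r x y i) y * φ y := fun i =>
    integral_mul_fderiv_eq_neg_fderiv_mul_of_integrable (hi2 i) (hi1 i) (hi3 i)
      (fun y _ => differentiable_gradKernel hr x i y) (fun y _ => hφ.differentiable y)
  simp_rw [hparts]
  rw [Finset.sum_neg_distrib, ← integral_finsetSum _ fun i _ => hi2 i, ← integral_neg]
  congr 1 with y
  rw [← Finset.sum_mul, sum_partialDeriv_gradKernel hr]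
  ring

/-! ### The `L²` error of mollifying a test function. -/

lemma norm_fderiv_apply_le (φ : Plane → ℂ) (x z : Plane) :
    ‖fderiv ℝ φ x z‖ ≤ ‖z‖ * ‖classicalGradient φ x‖ := by
  have h : fderiv ℝ φ x z = ∑ i, z i • partialDeriv i φ x := by
    conv_lhs => rw [← (EuclideanSpace.basisFun (Fin 2) ℝ).sum_repr z]
    simp [partialDeriv]
  rw [h]
  refine (norm_sum_le _ _).trans ?_
  simp_rw [norm_smul]
  refine (Real.sum_mul_le_sqrt_mul_sqrt _ _ _).trans_eq ?_
  rw [EuclideanSpace.norm_eq, EuclideanSpace.norm_eq]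
  rfl

lemma enorm_sub_shift_le {Ω : Set Plane} {φ : Plane → ℂ} (hφ : IsTestFunction Ω φ)
    (x z : Plane) :
    ‖φ x - φ (x - z)‖ₑ ≤
      ‖z‖ₑ * ∫⁻ t in Set.Ioc (0 : ℝ) 1, ‖classicalGradient φ (x - t • z)‖ₑ := by
  have hd : ∀ t ∈ Set.uIcc (0 : ℝ) 1,
      HasDerivAt (fun t : ℝ => φ (x - t • z)) (fderiv ℝ φ (x - t • z) (-z)) t := by
    intro t _
    have h1 : HasDerivAt (fun t : ℝ => x - t • z) (-z) t := by
      simpa using ((hasDerivAt_id t).smul_const z).const_sub x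
    exact (hφ.differentiable (x - t • z)).hasFDerivAt.comp_hasDerivAt t h1
  have hc : Continuous fun t : ℝ => fderiv ℝ φ (x - t • z) (-z) :=
    ((hφ.smooth.continuous_fderiv (by simp)).comp (by fun_prop)).clm_apply continuous_const
  have hftc := intervalIntegral.integral_eq_sub_of_hasDerivAt hd (hc.intervalIntegrable _ _)
  rw [one_smul, zero_smul, sub_zero, intervalIntegral.integral_of_le zero_le_one] at hftc
  rw [← enorm_neg, neg_sub, ← hftc, ← lintegral_const_mul']
  · refine (enorm_integral_le_lintegral_enorm _).trans (lintegral_mono fun t => ?_)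
    have := norm_fderiv_apply_le φ (x - t • z) (-z)
    rw [norm_neg] at this
    rw [← ofReal_norm, ← ofReal_norm, ← ofReal_norm, ← ENNReal.ofReal_mul (norm_nonneg _)]
    exact ENNReal.ofReal_le_ofReal this
  · exact enorm_ne_top

lemma sq_lintegral_le_measure_univ_mul {α : Type*} [MeasurableSpace α] (ν : Measure α)
    {f : α → ℝ≥0∞} (hf : AEMeasurable f ν) :
    (∫⁻ a, f a ∂ν) ^ 2 ≤ ν Set.univ * ∫⁻ a, f a ^ 2 ∂ν := by
  have h := ENNReal.lintegral_mul_le_Lp_mul_Lq ν Real.HolderConjugate.two_two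
    (aemeasurable_const (b := (1 : ℝ≥0∞))) hf
  simp only [Pi.mul_apply, one_mul, lintegral_one, ENNReal.rpow_two,
    one_pow] at h
  calc (∫⁻ a, f a ∂ν) ^ 2
      ≤ (ν Set.univ ^ (1 / 2 : ℝ) * (∫⁻ a, f a ^ 2 ∂ν) ^ (1 / 2 : ℝ)) ^ 2 := by gcongr
    _ = _ := by
      rw [mul_pow, ← ENNReal.rpow_natCast, ← ENNReal.rpow_natCast, ← ENNReal.rpow_mul,
        ← ENNReal.rpow_mul]
      norm_num

lemma sub_integral_mul_mollifier {Ω : Set Plane} {φ : Plane → ℂ} (hφ : IsTestFunction Ω φ)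
    {r : ℝ} (hr : 0 < r) (x : Plane) :
    φ x - ∫ y, φ y * (mollifier r (x - y) : ℂ)
      = ∫ z, (φ x - φ (x - z)) * (mollifier r z : ℂ) := by
  have h1 : ∫ y, φ y * (mollifier r (x - y) : ℂ) = ∫ z, φ (x - z) * (mollifier r z : ℂ) := by
    rw [← integral_sub_left_eq_self (fun z => φ (x - z) * (mollifier r z : ℂ)) volume x]
    simp
  have h2 : ∫ z, φ x * (mollifier r z : ℂ) = φ x := by
    rw [integral_const_mul, integral_complex_ofReal, integral_mollifier hr]
    simp
  have hi : Integrable fun z => (mollifier r z : ℂ) := (integrable_mollifier hr).ofReal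
  obtain ⟨C, hC⟩ := hφ.compact_support.exists_bound_of_continuous hφ.smooth.continuous
  rw [h1]
  simp_rw [sub_mul]
  rw [integral_sub (hi.const_mul _), h2]
  exact hi.bdd_mul (hφ.smooth.continuous.comp (by fun_prop)).aestronglyMeasurable
    (ae_of_all _ fun z => hC _)

/-- The measure `|z| p(z) dz ⊗ dt` on `ℝ² × (0, 1]`, `p` being the mollifier. -/
def segmentMeasure (r : ℝ) : Measure (Plane × ℝ) :=
  (volume.withDensity fun z => ENNReal.ofReal (‖z‖ * mollifier r z)).prod
    (volume.restrict (Set.Ioc 0 1))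

lemma withDensity_univ {r : ℝ} (hr : 0 < r) :
    (volume.withDensity fun z : Plane => ENNReal.ofReal (‖z‖ * mollifier r z)) Set.univ
      = ENNReal.ofReal (Real.pi * r / 2) := by
  rw [withDensity_apply _ MeasurableSet.univ, setLIntegral_univ,
    ← ofReal_integral_eq_lintegral_ofReal (integrable_norm_mul_mollifier hr)
      (ae_of_all _ fun z => mul_nonneg (norm_nonneg _) (mollifier_nonneg r z)),
    integral_norm_mul_mollifier hr]

lemma segmentMeasure_univ {r : ℝ} (hr : 0 < r) :
    segmentMeasure r Set.univ = ENNReal.ofReal (Real.pi * r / 2) := by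
  rw [segmentMeasure, ← Set.univ_prod_univ, Measure.prod_prod, withDensity_univ hr]
  simp

lemma measurable_weight {r : ℝ} (hr : 0 < r) :
    Measurable fun z : Plane => ENNReal.ofReal (‖z‖ * mollifier r z) :=
  (ENNReal.continuous_ofReal.comp (continuous_norm.mul (continuous_mollifier hr))).measurable

/-- Because `p_r` has mass one, the error is an average of the differences `φ x - φ (x - z)`; each
is bounded by `|z|` times an integral of the gradient over the segment, and `|z|` is absorbed into
the measure. -/
lemma enorm_sub_mollify_le {Ω : Set Plane} {φ : Plane → ℂ} (hφ : IsTestFunction Ω φ)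
    {r : ℝ} (hr : 0 < r) (x : Plane) :
    ‖φ x - ∫ y, φ y * (mollifier r (x - y) : ℂ)‖ₑ
      ≤ ∫⁻ q, ‖classicalGradient φ (x - q.2 • q.1)‖ₑ ∂(segmentMeasure r) := by
  have hG : Measurable fun q : Plane × ℝ => ‖classicalGradient φ (x - q.2 • q.1)‖ₑ :=
    (hφ.continuous_classicalGradient.comp (by fun_prop)).enorm.measurable
  rw [sub_integral_mul_mollifier hφ hr, segmentMeasure, lintegral_prod _ hG.aemeasurable,
    lintegral_withDensity_eq_lintegral_mul _ (measurable_weight hr) hG.lintegral_prod_right']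
  refine (enorm_integral_le_lintegral_enorm _).trans (lintegral_mono fun z => ?_)
  rw [enorm_mul, Pi.mul_apply, ENNReal.ofReal_mul (norm_nonneg _), ofReal_norm,
    ← ofReal_norm (mollifier r z : ℂ), Complex.norm_real,
    Real.norm_of_nonneg (mollifier_nonneg r z), mul_right_comm]
  gcongr
  exact enorm_sub_shift_le hφ x z

/-- Minkowski's inequality in squared form: Cauchy–Schwarz for `segmentMeasure r` gives one factor
of its mass; Tonelli and translation invariance give the other. -/
theorem lintegral_enorm_sub_mollify_sq_le {Ω : Set Plane} {φ : Plane → ℂ}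
    (hφ : IsTestFunction Ω φ) {r : ℝ} (hr : 0 < r) :
    ∫⁻ x, ‖φ x - ∫ y, φ y * (mollifier r (x - y) : ℂ)‖ₑ ^ 2
      ≤ ENNReal.ofReal (Real.pi * r / 2) ^ 2 * ∫⁻ x, ‖classicalGradient φ x‖ₑ ^ 2 := by
  have hG : Measurable fun w : Plane × (Plane × ℝ) =>
      ‖classicalGradient φ (w.1 - w.2.2 • w.2.1)‖ₑ :=
    (hφ.continuous_classicalGradient.comp (by fun_prop)).enorm.measurable
  have : IsFiniteMeasure
      (volume.withDensity fun z : Plane => ENNReal.ofReal (‖z‖ * mollifier r z)) :=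
    ⟨by rw [withDensity_univ hr]; exact ENNReal.ofReal_lt_top⟩
  have : IsFiniteMeasure (segmentMeasure r) :=
    ⟨by rw [segmentMeasure_univ hr]; exact ENNReal.ofReal_lt_top⟩
  calc ∫⁻ x, ‖φ x - ∫ y, φ y * (mollifier r (x - y) : ℂ)‖ₑ ^ 2
      ≤ ∫⁻ x, segmentMeasure r Set.univ *
          ∫⁻ q, ‖classicalGradient φ (x - q.2 • q.1)‖ₑ ^ 2 ∂(segmentMeasure r) := by
        refine lintegral_mono fun x => ?_
        refine le_trans (pow_le_pow_left₀ zero_le (enorm_sub_mollify_le hφ hr x) 2) ?_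
        exact sq_lintegral_le_measure_univ_mul _
          (hG.comp measurable_prodMk_left).aemeasurable
    _ = segmentMeasure r Set.univ * ∫⁻ q, (∫⁻ x, ‖classicalGradient φ (x - q.2 • q.1)‖ₑ ^ 2)
          ∂(segmentMeasure r) := by
        rw [lintegral_const_mul' _ _ (measure_ne_top _ _), lintegral_lintegral_swap]
        exact (hG.pow_const 2).aemeasurable
    _ = segmentMeasure r Set.univ * ∫⁻ _ : Plane × ℝ, (∫⁻ x, ‖classicalGradient φ x‖ₑ ^ 2)
          ∂(segmentMeasure r) := by
        congr 2 with q
        exact lintegral_sub_right_eq_self (fun x => ‖classicalGradient φ x‖ₑ ^ 2) (q.2 • q.1)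
    _ = _ := by
        rw [lintegral_const, segmentMeasure_univ hr]
        ring

/-! ### Uniqueness of weak gradients, to identify a given one with the one supplied by `MemH01`. -/

lemma setIntegral_mul_test_eq {Ω : Set Plane} {φ : Plane → ℂ} (hφ : tsupport φ ⊆ Ω)
    (f : Plane → ℂ) : ∫ x in Ω, f x * φ x = ∫ x, f x * φ x :=
  setIntegral_eq_integral_of_forall_compl_eq_zero fun x hx => by
    rw [image_eq_zero_of_notMem_tsupport fun h => hx (hφ h), mul_zero]

lemma integrable_smul_of_locallyIntegrableOn {Ω : Set Plane} {g : Plane → CVec}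
    (hg : LocallyIntegrableOn g Ω) {ψ : Plane → ℝ} (hψ : Continuous ψ)
    (hc : HasCompactSupport ψ) (hs : tsupport ψ ⊆ Ω) : Integrable fun x => ψ x • g x := by
  have h1 : IntegrableOn (fun x => ψ x • g x) (tsupport ψ) :=
    (hg.integrableOn_compact_subset hs hc).continuousOn_smul hψ.continuousOn hc
  exact (integrableOn_iff_integrable_of_support_subset
    ((Function.support_smul_subset_left ψ g).trans (subset_tsupport ψ))).1 h1

/-- Weak gradients on an open set are unique almost everywhere. -/
theorem IsWeakGradient.ae_eq {Ω : Set Plane} (hΩ : IsOpen Ω) {u : Plane → ℂ}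
    {g g' : Plane → CVec} (hg : IsWeakGradient Ω u g) (hg' : IsWeakGradient Ω u g') :
    g =ᵐ[volume.restrict Ω] g' := by
  have h := hΩ.ae_eq_zero_of_integral_contDiff_smul_eq_zero
    (hg.locallyIntegrableOn_grad.sub hg'.locallyIntegrableOn_grad) (μ := volume) ?_
  · rw [EventuallyEq, ae_restrict_iff' hΩ.measurableSet]
    filter_upwards [h] with x hx hxΩ
    exact sub_eq_zero.1 (hx hxΩ)
  · intro ψ hψ hc hs
    have hts : tsupport (fun x => (ψ x : ℂ)) ⊆ tsupport ψ :=
      closure_mono fun x hx => by simpa using hx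
    have htest : IsTestFunction Ω fun x => (ψ x : ℂ) :=
      ⟨Complex.ofRealCLM.contDiff.comp hψ, hc.comp_left (g := fun t : ℝ => (t : ℂ)) (by simp),
        hts.trans hs⟩
    have hi : Integrable fun x => ψ x • g x := integrable_smul_of_locallyIntegrableOn
      hg.locallyIntegrableOn_grad hψ.continuous hc hs
    have hi' : Integrable fun x => ψ x • g' x := integrable_smul_of_locallyIntegrableOn
      hg'.locallyIntegrableOn_grad hψ.continuous hc hs
    have hcomp : ∀ {k : Plane → CVec}, (Integrable fun x => ψ x • k x) → ∀ i,
        (∫ x, ψ x • k x) i = ∫ x in Ω, k x i * (ψ x : ℂ) := by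
      intro k hk i
      rw [setIntegral_mul_test_eq (hts.trans hs)]
      refine ((EuclideanSpace.proj i : CVec →L[ℂ] ℂ).integral_comp_comm hk).symm.trans ?_
      congr 1 with x
      simp [mul_comm]
    simp_rw [Pi.sub_apply, smul_sub]
    rw [integral_sub hi hi', sub_eq_zero]
    ext i
    rw [hcomp hi, hcomp hi', ← neg_inj, ← hg.integral_eq _ htest, ← hg'.integral_eq _ htest]

/-! ### Regularisation: Bessel's inequality and passage from test functions to `H_0^1`. -/

/-- The regularisation `x ↦ ∫_Ω k_r(x - y) · g(y) dy` of a function with gradient `g`. -/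
def regularize (Ω : Set Plane) (r : ℝ) (g : Plane → CVec) (x : Plane) : ℂ :=
  ∫ y in Ω, inner ℂ (gradKernel r x y) (g y)

lemma integrable_inner_of_memLp_two {α : Type*} [MeasurableSpace α] {μ : Measure α}
    {f g : α → CVec} (hf : MemLp f 2 μ) (hg : MemLp g 2 μ) :
    Integrable (fun y => inner ℂ (f y) (g y)) μ := by
  refine (L2.integrable_inner (𝕜 := ℂ) hf.toLp hg.toLp).congr ?_
  filter_upwards [hf.coeFn_toLp, hg.coeFn_toLp] with y h1 h2
  rw [h1, h2]

lemma inner_toLp_toLp {α : Type*} [MeasurableSpace α] {μ : Measure α}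
    {f g : α → CVec} (hf : MemLp f 2 μ) (hg : MemLp g 2 μ) :
    inner ℂ hf.toLp hg.toLp = ∫ y, inner ℂ (f y) (g y) ∂μ := by
  rw [L2.inner_def]
  refine integral_congr_ae ?_
  filter_upwards [hf.coeFn_toLp, hg.coeFn_toLp] with y h1 h2
  rw [h1, h2]

lemma norm_toLp_sq {α : Type*} [MeasurableSpace α] {μ : Measure α}
    {f : α → CVec} (hf : MemLp f 2 μ) : ‖hf.toLp‖ ^ 2 = ∫ y, ‖f y‖ ^ 2 ∂μ := by
  have h : ((‖hf.toLp‖ ^ 2 : ℝ) : ℂ) = ((∫ y, ‖f y‖ ^ 2 ∂μ : ℝ) : ℂ) := by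
    rw [← integral_complex_ofReal]
    push_cast
    rw [← Complex.coe_algebraMap, ← inner_self_eq_norm_sq_to_K, inner_toLp_toLp]
    simp_rw [inner_self_eq_norm_sq_to_K]
  exact_mod_cast h

lemma orthonormal_toLp {α : Type*} [MeasurableSpace α] {μ : Measure α} {N : ℕ}
    {g : Fin N → α → CVec} (hg : ∀ n, MemLp (g n) 2 μ)
    (horth : ∀ n m, ∫ x, inner ℂ (g n x) (g m x) ∂μ = if m = n then 1 else 0) :
    Orthonormal ℂ fun n => (hg n).toLp := by
  rw [orthonormal_iff_ite]
  intro n m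
  rw [inner_toLp_toLp, horth]
  simp only [eq_comm]

/-- Bessel's inequality for the regularisations of functions with orthonormal gradients. -/
theorem sum_norm_regularize_sq_le {Ω : Set Plane} (hfin : volume Ω ≠ ⊤) {N : ℕ}
    {g : Fin N → Plane → CVec} (hg : ∀ n, MemLp (g n) 2 (volume.restrict Ω))
    (horth : ∀ n m, ∫ x in Ω, inner ℂ (g n x) (g m x) = if m = n then 1 else 0)
    {r : ℝ} (hr : 0 < r) (x : Plane) :
    ∑ n, ‖regularize Ω r (g n) x‖ ^ 2 ≤ ∫ y in Ω, ‖gradKernel r x y‖ ^ 2 := by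
  have hK := memLp_gradKernel hr x hfin
  have := (orthonormal_toLp hg horth).sum_inner_products_le (s := Finset.univ) (x := hK.toLp)
  rw [norm_toLp_sq] at this
  refine le_trans (le_of_eq ?_) this
  refine Finset.sum_congr rfl fun n _ => ?_
  rw [norm_inner_symm, inner_toLp_toLp]
  rfl

lemma eLpNorm_eq_one_of_integral_inner {α : Type*} [MeasurableSpace α] {μ : Measure α}
    {g : α → CVec} (hg : MemLp g 2 μ) (h : ∫ x, inner ℂ (g x) (g x) ∂μ = 1) :
    eLpNorm g 2 μ = 1 := by
  have h1 : ‖hg.toLp‖ = 1 := by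
    rw [← sq_eq_sq₀ (norm_nonneg _) zero_le_one, one_pow]
    have := inner_self_eq_norm_sq (𝕜 := ℂ) hg.toLp
    rw [inner_toLp_toLp, h] at this
    simpa using this.symm
  rwa [Lp.norm_toLp, ENNReal.toReal_eq_one_iff] at h1

lemma aestronglyMeasurable_regularize {Ω : Set Plane} {g : Plane → CVec}
    (hg : AEStronglyMeasurable g (volume.restrict Ω)) {r : ℝ} (hr : 0 < r) :
    AEStronglyMeasurable (regularize Ω r g) (volume.restrict Ω) := by
  have h : AEStronglyMeasurable
      (fun q : Plane × Plane => inner ℂ (gradKernel r q.1 q.2) (g q.2))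
      ((volume.restrict Ω).prod (volume.restrict Ω)) :=
    (continuous_gradKernel hr).aestronglyMeasurable.inner hg.comp_snd
  exact h.integral_prod_right'

/-- A crude bound whose constant degenerates as `r → 0`. It serves only as continuity in `g` at
fixed `r`, for the limit along test functions. -/
lemma eLpNorm_regularize_le {Ω : Set Plane} {g : Plane → CVec}
    (hg : AEStronglyMeasurable g (volume.restrict Ω)) {r : ℝ} (hr : 0 < r) :
    eLpNorm (regularize Ω r g) 2 (volume.restrict Ω)
      ≤ ENNReal.ofReal (1 / (2 * Real.pi * r)) * volume Ω * eLpNorm g 2 (volume.restrict Ω) := by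
  have hpt : ∀ x, ‖regularize Ω r g x‖ₑ ≤
      ENNReal.ofReal (1 / (2 * Real.pi * r)) *
        (eLpNorm g 2 (volume.restrict Ω) * volume Ω ^ (1 / 2 : ℝ)) := by
    intro x
    calc ‖regularize Ω r g x‖ₑ
        ≤ ∫⁻ y in Ω, ‖inner ℂ (gradKernel r x y) (g y)‖ₑ := enorm_integral_le_lintegral_enorm _
      _ ≤ ∫⁻ y in Ω, ENNReal.ofReal (1 / (2 * Real.pi * r)) * ‖g y‖ₑ := by
        refine lintegral_mono fun y => ?_
        rw [← ofReal_norm, ← ofReal_norm, ← ENNReal.ofReal_mul (by positivity)]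
        refine ENNReal.ofReal_le_ofReal ((norm_inner_le_norm _ _).trans ?_)
        exact mul_le_mul_of_nonneg_right (norm_gradKernel_le hr x y) (norm_nonneg _)
      _ = ENNReal.ofReal (1 / (2 * Real.pi * r)) * eLpNorm g 1 (volume.restrict Ω) := by
        rw [lintegral_const_mul' _ _ ENNReal.ofReal_ne_top, eLpNorm_one_eq_lintegral_enorm]
      _ ≤ _ := by
        gcongr
        have := eLpNorm_le_eLpNorm_mul_rpow_measure_univ (p := 1) (q := 2) (by norm_num) hg
        have he : (1 / ENNReal.toReal 1 - 1 / ENNReal.toReal 2 : ℝ) = 1 / 2 := by norm_num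
        rwa [Measure.restrict_apply_univ, he] at this
  refine (eLpNorm_le_of_ae_enorm_bound (ae_of_all _ hpt)).trans_eq ?_
  have h : volume Ω = volume Ω ^ (1 / 2 : ℝ) * volume Ω ^ (1 / 2 : ℝ) := by
    rw [← ENNReal.rpow_add_of_nonneg _ _ (by norm_num) (by norm_num)]
    norm_num
  rw [Measure.restrict_apply_univ, smul_eq_mul]
  conv_rhs => rw [h]
  rw [ENNReal.toReal_ofNat, ← one_div]
  ring

lemma support_classicalGradient_subset {Ω : Set Plane} {φ : Plane → ℂ}
    (hφ : IsTestFunction Ω φ) : Function.support (classicalGradient φ) ⊆ Ω := by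
  intro x hx
  by_contra hxΩ
  refine hx ?_
  have h : fderiv ℝ φ x = 0 := by
    by_contra h
    exact hxΩ (hφ.support_subset (support_fderiv_subset ℝ h))
  ext i
  simp [classicalGradient, partialDeriv, h]

lemma regularize_classicalGradient {Ω : Set Plane} {φ : Plane → ℂ}
    (hφ : IsTestFunction Ω φ) {r : ℝ} (hr : 0 < r) (x : Plane) :
    regularize Ω r (classicalGradient φ) x = ∫ y, φ y * (mollifier r (x - y) : ℂ) := by
  rw [← integral_inner_gradKernel_classicalGradient hφ hr]
  refine setIntegral_eq_integral_of_forall_compl_eq_zero fun y hy => ?_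
  have : classicalGradient φ y = 0 := by
    by_contra h
    exact hy (support_classicalGradient_subset hφ h)
  rw [this, inner_zero_right]

lemma eLpNorm_two_sq {α E : Type*} [MeasurableSpace α] [NormedAddCommGroup E] (f : α → E)
    (μ : Measure α) : eLpNorm f 2 μ ^ 2 = ∫⁻ x, ‖f x‖ₑ ^ 2 ∂μ := by
  have := eLpNorm_nnreal_pow_eq_lintegral (f := f) (μ := μ) (p := 2) two_ne_zero
  simpa using this

lemma IsTestFunction.eLpNorm_sub_regularize_le {Ω : Set Plane} {φ : Plane → ℂ}
    (hφ : IsTestFunction Ω φ) {r : ℝ} (hr : 0 < r) :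
    eLpNorm (fun x => φ x - regularize Ω r (classicalGradient φ) x) 2 (volume.restrict Ω)
      ≤ ENNReal.ofReal (Real.pi * r / 2) *
        eLpNorm (classicalGradient φ) 2 (volume.restrict Ω) := by
  rw [eLpNorm_restrict_eq_of_support_subset (support_classicalGradient_subset hφ)]
  refine (eLpNorm_restrict_le _ _ _ _).trans ?_
  rw [← ENNReal.pow_le_pow_left_iff two_ne_zero, mul_pow, eLpNorm_two_sq, eLpNorm_two_sq]
  simp_rw [regularize_classicalGradient hφ hr]
  exact lintegral_enorm_sub_mollify_sq_le hφ hr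

/-- Functions in `H_0^1` are close in `L²` to their regularisations. -/
theorem MemH01.eLpNorm_sub_regularize_le {Ω : Set Plane} (hΩ : IsOpen Ω) (hfin : volume Ω ≠ ⊤)
    {u : Plane → ℂ} (hu : MemH01 Ω u) {g : Plane → CVec} (hg : IsWeakGradient Ω u g)
    {r : ℝ} (hr : 0 < r) :
    eLpNorm (fun x => u x - regularize Ω r g x) 2 (volume.restrict Ω)
      ≤ ENNReal.ofReal (Real.pi * r / 2) * eLpNorm g 2 (volume.restrict Ω) := by
  obtain ⟨hu2, g', hg', hg'2, φ, hφ, hlim, hlim'⟩ := hu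
  have hae := hg.ae_eq hΩ hg'
  have hreg : regularize Ω r g = regularize Ω r g' := by
    ext x
    exact integral_congr_ae (hae.mono fun y hy => by simp only [hy])
  rw [hreg, eLpNorm_congr_ae hae]
  set μ := volume.restrict Ω
  set c := ENNReal.ofReal (Real.pi * r / 2)
  set d := ENNReal.ofReal (1 / (2 * Real.pi * r)) * volume Ω with hd
  have hd_top : d ≠ ⊤ := ENNReal.mul_ne_top ENNReal.ofReal_ne_top hfin
  have hgrad : ∀ k, MemLp (classicalGradient (φ k)) 2 μ := fun k =>
    ((hφ k).continuous_classicalGradient.memLp_of_hasCompactSupport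
      (HasCompactSupport.of_support_subset_isCompact (hφ k).compact_support fun x hx =>
        by_contra fun hxs => hx (by
          ext i
          have : fderiv ℝ (φ k) x = 0 := by
            by_contra h
            exact hxs (support_fderiv_subset ℝ h)
          simp [classicalGradient, partialDeriv, this]))).restrict Ω
  have hφm : ∀ k, AEStronglyMeasurable (φ k) μ := fun k =>
    (hφ k).smooth.continuous.aestronglyMeasurable
  -- Insert `φ k` and its regularisation; every term containing an approximation error vanishes as
  -- `k → ∞`.
  have hbound : ∀ k, eLpNorm (fun x => u x - regularize Ω r g' x) 2 μ ≤
      eLpNorm (fun x => φ k x - u x) 2 μ +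
        (c * (eLpNorm g' 2 μ + eLpNorm (fun x => classicalGradient (φ k) x - g' x) 2 μ) +
          d * eLpNorm (fun x => classicalGradient (φ k) x - g' x) 2 μ) := by
    intro k
    have hm1 := aestronglyMeasurable_regularize (hgrad k).1 hr
    have hm2 := aestronglyMeasurable_regularize ((hgrad k).sub hg'2).1 hr
    have hsplit : (fun x => u x - regularize Ω r g' x) = (fun x => u x - φ k x) +
        ((fun x => φ k x - regularize Ω r (classicalGradient (φ k)) x) +
          regularize Ω r (classicalGradient (φ k) - g')) := by
      ext x
      have : regularize Ω r (classicalGradient (φ k) - g') x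
          = regularize Ω r (classicalGradient (φ k)) x - regularize Ω r g' x := by
        simp only [regularize, Pi.sub_apply, inner_sub_right]
        exact integral_sub (integrable_inner_of_memLp_two (memLp_gradKernel hr x hfin) (hgrad k))
          (integrable_inner_of_memLp_two (memLp_gradKernel hr x hfin) hg'2)
      simp only [Pi.add_apply, this]
      ring
    have hgk : eLpNorm (classicalGradient (φ k)) 2 μ ≤ eLpNorm g' 2 μ +
        eLpNorm (fun x => classicalGradient (φ k) x - g' x) 2 μ := by
      have := eLpNorm_add_le hg'2.1 ((hgrad k).sub hg'2).1 (p := 2) (by norm_num)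
      rwa [add_sub_cancel] at this
    rw [hsplit]
    refine (eLpNorm_add_le (hu2.1.sub (hφm k)) (((hφm k).sub hm1).add hm2) (by norm_num)).trans ?_
    refine add_le_add (le_of_eq (eLpNorm_sub_comm _ _ _ _)) ?_
    refine (eLpNorm_add_le ((hφm k).sub hm1) hm2 (by norm_num)).trans (add_le_add ?_ ?_)
    · exact ((hφ k).eLpNorm_sub_regularize_le hr).trans (mul_le_mul_right hgk _)
    · exact eLpNorm_regularize_le ((hgrad k).sub hg'2).1 hr
  have hl : Tendsto (fun k => eLpNorm (fun x => φ k x - u x) 2 μ +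
        (c * (eLpNorm g' 2 μ + eLpNorm (fun x => classicalGradient (φ k) x - g' x) 2 μ) +
          d * eLpNorm (fun x => classicalGradient (φ k) x - g' x) 2 μ)) atTop
      (𝓝 (0 + (c * (eLpNorm g' 2 μ + 0) + d * 0))) :=
    hlim.add ((ENNReal.Tendsto.const_mul (tendsto_const_nhds.add hlim')
      (Or.inr ENNReal.ofReal_ne_top)).add (ENNReal.Tendsto.const_mul hlim' (Or.inr hd_top)))
  have := ge_of_tendsto' hl hbound
  simpa using this

/-! ### Decay of the level sets. -/

lemma density_nonneg {N : ℕ} (u : Fin N → Plane → ℂ) (x : Plane) : 0 ≤ density u x :=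
  Finset.sum_nonneg fun _ _ => by positivity

lemma aemeasurable_density {N : ℕ} {u : Fin N → Plane → ℂ} {μ : Measure Plane}
    (hu : ∀ n, AEStronglyMeasurable (u n) μ) : AEMeasurable (density u) μ := by
  unfold density
  exact Finset.aemeasurable_fun_sum _ fun n _ => (hu n).norm.aemeasurable.pow_const 2

/-- Young's inequality weighted by `2a`: the factor `1 + 1/(2a)` enlarges `a - 1` to less than `a -
1/2`, so the main term stays below level `a`. -/
lemma sum_norm_sq_le {N : ℕ} (p q : Fin N → ℂ) {a : ℝ} (ha : 0 < a) :
    ∑ n, ‖p n‖ ^ 2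
      ≤ (1 + 1 / (2 * a)) * ∑ n, ‖q n‖ ^ 2 + (1 + 2 * a) * ∑ n, ‖p n - q n‖ ^ 2 := by
  rw [Finset.mul_sum, Finset.mul_sum, ← Finset.sum_add_distrib]
  refine Finset.sum_le_sum fun n _ => ?_
  have h1 : ‖p n‖ ≤ ‖q n‖ + ‖p n - q n‖ := by
    simpa using norm_add_le (q n) (p n - q n)
  have h2 : 2 * ‖q n‖ * ‖p n - q n‖ ≤ 1 / (2 * a) * ‖q n‖ ^ 2 + 2 * a * ‖p n - q n‖ ^ 2 := by
    have : 0 ≤ (‖q n‖ - 2 * a * ‖p n - q n‖) ^ 2 / (2 * a) := by positivity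
    have h : (‖q n‖ - 2 * a * ‖p n - q n‖) ^ 2 / (2 * a)
        = 1 / (2 * a) * ‖q n‖ ^ 2 + 2 * a * ‖p n - q n‖ ^ 2 - 2 * ‖q n‖ * ‖p n - q n‖ := by
      field_simp
      ring
    linarith
  nlinarith [norm_nonneg (p n), pow_le_pow_left₀ (norm_nonneg _) h1 2]

/-- The level sets of the density of finitely many functions in `H_0^1` with orthonormal gradients,
in terms of the regularisation length `r`. -/
lemma measure_density_ge_le_of_radius {Ω : Set Plane} (hΩ : IsOpen Ω) (hfin : volume Ω ≠ ⊤) {N : ℕ}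
    {u : Fin N → Plane → ℂ} (hu : ∀ n, MemH01 Ω (u n))
    {g : Fin N → Plane → CVec} (hg : ∀ n, IsWeakGradient Ω (u n) (g n))
    (hg2 : ∀ n, MemLp (g n) 2 (volume.restrict Ω))
    (horth : ∀ n m, ∫ x in Ω, inner ℂ (g n x) (g m x) = if m = n then 1 else 0)
    {a r : ℝ} (ha : 0 < a) (hr : 0 < r)
    (har : Real.log (1 + volume.real Ω / (Real.pi * r ^ 2)) = a - 2) :
    volume.restrict Ω {x | a ≤ 4 * Real.pi * density u x}
      ≤ ENNReal.ofReal (2 * Real.pi ^ 3 * (1 + 2 * a) * r ^ 2 * N) := by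
  set μ := volume.restrict Ω
  have hpi := Real.pi_pos
  set w : Fin N → Plane → ℂ := fun n x => u n x - regularize Ω r (g n) x
  have hw : ∀ n, AEStronglyMeasurable (w n) μ := fun n =>
    (hu n).1.1.sub (aestronglyMeasurable_regularize (hg2 n).1 hr)
  have hwm : ∀ n, AEMeasurable (fun x => ‖w n x‖ₑ ^ 2) μ := fun n => (hw n).enorm.pow_const 2
  -- The mollified part contributes at most `a - 1/2` to `4πρ`, so the remainder term `4π(1 + 2a) ∑
  -- |w n|²` must supply at least `1/2`.
  have hsub : {x | a ≤ 4 * Real.pi * density u x} ⊆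
      {x | ENNReal.ofReal (1 / (8 * Real.pi * (1 + 2 * a))) ≤ ∑ n, ‖w n x‖ₑ ^ 2} := by
    intro x hx
    have hW : ∑ n, ‖w n x‖ₑ ^ 2 = ENNReal.ofReal (∑ n, ‖w n x‖ ^ 2) := by
      rw [ENNReal.ofReal_sum_of_nonneg fun _ _ => by positivity]
      simp_rw [ENNReal.ofReal_pow (norm_nonneg _), ofReal_norm]
    simp only [Set.mem_ofPred_eq] at hx ⊢
    rw [hW]
    refine ENNReal.ofReal_le_ofReal ?_
    have h1 := sum_norm_sq_le (fun n => u n x) (fun n => regularize Ω r (g n) x) ha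
    have h2 := (sum_norm_regularize_sq_le hfin hg2 horth hr x).trans
      (integral_norm_gradKernel_sq_le hr x hΩ.measurableSet hfin)
    rw [har, le_div_iff₀ (by positivity)] at h2
    have h3 : (1 + 1 / (2 * a)) * (a - 1) ≤ a - 1 / 2 := by
      have : (1 + 1 / (2 * a)) * (a - 1) = a - 1 / 2 - 1 / (2 * a) := by field_simp; ring
      have h0 : 0 < 1 / (2 * a) := by positivity
      linarith
    have h4 : (1 + 1 / (2 * a)) * ((∑ n, ‖regularize Ω r (g n) x‖ ^ 2) * (4 * Real.pi))
        ≤ (1 + 1 / (2 * a)) * (a - 1) :=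
      mul_le_mul_of_nonneg_left (by linarith) (by positivity)
    have h5 : 4 * Real.pi * density u x ≤ 4 * Real.pi *
        ((1 + 1 / (2 * a)) * ∑ n, ‖regularize Ω r (g n) x‖ ^ 2 +
          (1 + 2 * a) * ∑ n, ‖w n x‖ ^ 2) :=
      mul_le_mul_of_nonneg_left h1 (by positivity)
    rw [div_le_iff₀ (by positivity)]
    nlinarith
  have hint : ∫⁻ x, ∑ n, ‖w n x‖ₑ ^ 2 ∂μ ≤ ENNReal.ofReal (N * (Real.pi * r / 2) ^ 2) := by
    rw [lintegral_finsetSum' _ fun n _ => hwm n]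
    calc ∑ n, ∫⁻ x, ‖w n x‖ₑ ^ 2 ∂μ
        ≤ ∑ _n : Fin N, ENNReal.ofReal (Real.pi * r / 2) ^ 2 := by
          refine Finset.sum_le_sum fun n _ => ?_
          have h := (hu n).eLpNorm_sub_regularize_le hΩ hfin (hg n) hr
          rw [eLpNorm_eq_one_of_integral_inner (hg2 n) (by simpa using horth n n), mul_one] at h
          rw [← eLpNorm_two_sq]
          gcongr
      _ = _ := by
          rw [Finset.sum_const, Finset.card_univ, Fintype.card_fin, nsmul_eq_mul,
            ENNReal.ofReal_mul (by positivity), ENNReal.ofReal_natCast,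
            ENNReal.ofReal_pow (by positivity)]
  have hc : 0 < 1 / (8 * Real.pi * (1 + 2 * a)) := by positivity
  calc μ {x | a ≤ 4 * Real.pi * density u x}
      ≤ μ {x | ENNReal.ofReal (1 / (8 * Real.pi * (1 + 2 * a))) ≤ ∑ n, ‖w n x‖ₑ ^ 2} :=
        measure_mono hsub
    _ ≤ (∫⁻ x, ∑ n, ‖w n x‖ₑ ^ 2 ∂μ) / ENNReal.ofReal (1 / (8 * Real.pi * (1 + 2 * a))) :=
        meas_ge_le_lintegral_div (Finset.aemeasurable_fun_sum _ fun n _ => hwm n)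
          (by simpa using hc) ENNReal.ofReal_ne_top
    _ ≤ ENNReal.ofReal (N * (Real.pi * r / 2) ^ 2) /
          ENNReal.ofReal (1 / (8 * Real.pi * (1 + 2 * a))) := by gcongr
    _ = _ := by
        rw [← ENNReal.ofReal_div_of_pos hc]
        congr 1
        field_simp
        ring

/-- Exponential decay of the level sets of the density. -/
theorem measure_density_ge_le {Ω : Set Plane} (hΩ : IsOpen Ω) (hfin : volume Ω ≠ ⊤)
    (hpos : 0 < volume.real Ω) {N : ℕ} (hN : 1 ≤ N)
    {u : Fin N → Plane → ℂ} (hu : ∀ n, MemH01 Ω (u n))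
    {g : Fin N → Plane → CVec} (hg : ∀ n, IsWeakGradient Ω (u n) (g n))
    (hg2 : ∀ n, MemLp (g n) 2 (volume.restrict Ω))
    (horth : ∀ n m, ∫ x in Ω, inner ℂ (g n x) (g m x) = if m = n then 1 else 0)
    {a : ℝ} (ha : 0 ≤ a) :
    volume.restrict Ω {x | a ≤ 4 * Real.pi * density u x}
      ≤ ENNReal.ofReal (500 * N * volume.real Ω * (a + 1) * Real.exp (-a)) := by
  have hpi := Real.pi_pos
  have hN' : (1 : ℝ) ≤ N := by exact_mod_cast hN
  have he : Real.exp 1 < 2.7182818286 := Real.exp_one_lt_d9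
  have he' : 2.7182818283 < Real.exp 1 := Real.exp_one_gt_d9
  -- The choice of `r` needs `a` to stay above `2`; for `a < 3` the trivial bound `|Ω|` suffices, as
  -- `500 e⁻³ > 1`.
  rcases lt_or_ge a 3 with h3 | h3
  · calc volume.restrict Ω {x | a ≤ 4 * Real.pi * density u x}
        ≤ volume.restrict Ω Set.univ := measure_mono (Set.subset_univ _)
      _ = ENNReal.ofReal (volume.real Ω) := by
          rw [Measure.restrict_apply_univ, Measure.real, ENNReal.ofReal_toReal hfin]
      _ ≤ _ := by
          refine ENNReal.ofReal_le_ofReal ?_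
          have h1 : Real.exp (-3) ≤ Real.exp (-a) := Real.exp_le_exp.2 (by linarith)
          have h2 : 1 / 27 ≤ Real.exp (-3) := by
            rw [Real.exp_neg, ← one_div]
            refine one_div_le_one_div_of_le (Real.exp_pos _) ?_
            have : Real.exp 3 = Real.exp 1 ^ 3 := by rw [← Real.exp_nat_mul]; norm_num
            rw [this]
            exact (pow_le_pow_left₀ (Real.exp_pos _).le he.le 3).trans (by norm_num)
          calc volume.real Ω = 27 * 1 * volume.real Ω * 1 * (1 / 27) := by ring
            _ ≤ 500 * N * volume.real Ω * (a + 1) * Real.exp (-a) := by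
              gcongr
              · norm_num
              · linarith
              · exact h2.trans h1
  · set E := Real.exp (a - 2)
    have hE : Real.exp 1 ≤ E := Real.exp_le_exp.2 (by linarith)
    have hE1 : 0 < E - 1 := by linarith
    have hEa : Real.exp (-a) = Real.exp (-2) / E := by
      rw [← Real.exp_sub]; congr 1; ring
    -- The solution of `log(1 + |Ω|/(πr²)) = a - 2`.
    set r := Real.sqrt (volume.real Ω / (Real.pi * (E - 1)))
    have hr2 : r ^ 2 = volume.real Ω / (Real.pi * (E - 1)) := Real.sq_sqrt (by positivity)
    have hr : 0 < r := Real.sqrt_pos.2 (by positivity)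
    have har : Real.log (1 + volume.real Ω / (Real.pi * r ^ 2)) = a - 2 := by
      rw [hr2]
      have : 1 + volume.real Ω / (Real.pi * (volume.real Ω / (Real.pi * (E - 1)))) = E := by
        field_simp
        ring
      rw [this, Real.log_exp]
    refine (measure_density_ge_le_of_radius hΩ hfin hu hg hg2 horth (by linarith) hr har).trans
      (ENNReal.ofReal_le_ofReal ?_)
    rw [hr2]
    have hpi2 : Real.pi ^ 2 ≤ 10 := by nlinarith [Real.pi_lt_d4]
    -- As `E ≥ e`, `E / (E - 1) ≤ e / (e - 1)`, and `e³ / (e - 1) < 12`.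
    have hexp : 1 / (E - 1) ≤ 12 * Real.exp (-a) := by
      have h2 : Real.exp (-2) = 1 / Real.exp 1 ^ 2 := by
        rw [Real.exp_neg, ← one_div, ← Real.exp_nat_mul]; norm_num
      rw [hEa, h2, div_div, mul_one_div, div_le_div_iff₀ hE1 (by positivity)]
      have h4 : Real.exp 1 ^ 2 ≤ 7.3891 :=
        (pow_le_pow_left₀ (Real.exp_pos _).le he.le 2).trans (by norm_num)
      nlinarith
    calc 2 * Real.pi ^ 3 * (1 + 2 * a) * (volume.real Ω / (Real.pi * (E - 1))) * N
        = 2 * Real.pi ^ 2 * (1 + 2 * a) * volume.real Ω * N * (1 / (E - 1)) := by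
          field_simp
      _ ≤ 2 * 10 * (2 * (a + 1)) * volume.real Ω * N * (12 * Real.exp (-a)) := by
          gcongr
          linarith
      _ = 480 * (N * volume.real Ω * (a + 1) * Real.exp (-a)) := by ring
      _ ≤ 500 * (N * volume.real Ω * (a + 1) * Real.exp (-a)) := by
          gcongr
          norm_num
      _ = _ := by ring

/-! ### From level sets to exponential integrals. -/

/-- The single term `k = ⌊t⌋` already dominates, since `t < k + 1`. -/
lemma ofReal_exp_mul_le_tsum {c t : ℝ} (hc : 0 ≤ c) (ht : 0 ≤ t) :
    ENNReal.ofReal (Real.exp (c * t)) ≤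
      ∑' k : ℕ, if (k : ℝ) ≤ t then ENNReal.ofReal (Real.exp (c * (k + 1))) else 0 := by
  refine le_trans ?_ (ENNReal.le_tsum ⌊t⌋₊)
  rw [if_pos (Nat.floor_le ht)]
  refine ENNReal.ofReal_le_ofReal (Real.exp_le_exp.2 ?_)
  exact mul_le_mul_of_nonneg_left (Nat.lt_floor_add_one t).le hc

lemma hasSum_succ_mul_geometric {q : ℝ} (h0 : 0 ≤ q) (h1 : q < 1) :
    HasSum (fun k : ℕ => ((k : ℝ) + 1) * q ^ (k + 1)) (q / (1 - q) ^ 2) := by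
  have h := hasSum_coe_mul_geometric_of_norm_lt_one (r := q) (by rwa [Real.norm_of_nonneg h0])
  have := (hasSum_nat_add_iff' 1).2 h
  simpa using this

lemma exp_neg_div_one_sub_sq_le {ε : ℝ} (hε : 0 < ε) (hε' : ε ≤ 1 / 4) :
    Real.exp (-ε) / (1 - Real.exp (-ε)) ^ 2 ≤ 2 / ε ^ 2 := by
  -- `(1 - 4ε/5)(1 + ε) ≥ 1` holds exactly up to `ε = 1/4`.
  have h1 : Real.exp (-ε) ≤ 1 - 4 / 5 * ε := by
    have h := Real.add_one_le_exp ε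
    have hmul : Real.exp (-ε) * Real.exp ε = 1 := by rw [← Real.exp_add]; simp
    have hpos := Real.exp_pos (-ε)
    have h2 : Real.exp (-ε) * (ε + 1) ≤ 1 := by nlinarith
    have h3 : 1 ≤ (1 - 4 / 5 * ε) * (ε + 1) := by nlinarith
    exact le_of_mul_le_mul_right (h2.trans h3) (by linarith)
  have h4 : Real.exp (-ε) ≤ 1 := by linarith
  calc Real.exp (-ε) / (1 - Real.exp (-ε)) ^ 2 ≤ 1 / (4 / 5 * ε) ^ 2 := by
        gcongr
        linarith
    _ ≤ 2 / ε ^ 2 := by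
        rw [div_le_div_iff₀ (by positivity) (by positivity)]
        nlinarith [sq_nonneg ε]

/-- Exponential decay of the level sets gives exponential integrability. -/
lemma lintegral_exp_le_of_measure_ge_le {α : Type*} [MeasurableSpace α] {μ : Measure α}
    {f : α → ℝ} (hf : AEMeasurable f μ) (hf0 : ∀ x, 0 ≤ f x) {C : ℝ} (hC : 0 ≤ C)
    (hμ : ∀ a : ℝ, 0 ≤ a → μ {x | a ≤ f x} ≤ ENNReal.ofReal (C * (a + 1) * Real.exp (-a)))
    {ε : ℝ} (hε : 0 < ε) (hε' : ε ≤ 1 / 4) :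
    ∫⁻ x, ENNReal.ofReal (Real.exp ((1 - ε) * f x)) ∂μ
      ≤ ENNReal.ofReal (C * Real.exp 1 * (2 / ε ^ 2)) := by
  have hnull : ∀ k : ℕ, NullMeasurableSet {x | (k : ℝ) ≤ f x} μ := fun k =>
    nullMeasurableSet_le aemeasurable_const hf
  -- The factor `e` is the cost of evaluating the exponential at `k + 1` but the level set at `k`.
  have hterm : ∀ k : ℕ, Real.exp ((1 - ε) * (k + 1)) * (C * ((k : ℝ) + 1) * Real.exp (-k))
      = C * Real.exp 1 * (((k : ℝ) + 1) * Real.exp (-ε) ^ (k + 1)) := by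
    intro k
    have : Real.exp ((1 - ε) * (k + 1)) * Real.exp (-k) = Real.exp 1 * Real.exp (-ε) ^ (k + 1) := by
      rw [← Real.exp_nat_mul, ← Real.exp_add, ← Real.exp_add]
      congr 1
      push_cast
      ring
    linear_combination C * ((k : ℝ) + 1) * this
  have hsum := (hasSum_succ_mul_geometric (Real.exp_pos (-ε)).le
    (by simpa using hε)).mul_left (C * Real.exp 1)
  calc ∫⁻ x, ENNReal.ofReal (Real.exp ((1 - ε) * f x)) ∂μ
      ≤ ∫⁻ x, ∑' k : ℕ, {x | (k : ℝ) ≤ f x}.indicator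
          (fun _ => ENNReal.ofReal (Real.exp ((1 - ε) * (k + 1)))) x ∂μ :=
        lintegral_mono fun x => ofReal_exp_mul_le_tsum (by linarith) (hf0 x)
    _ = ∑' k : ℕ, ENNReal.ofReal (Real.exp ((1 - ε) * (k + 1))) * μ {x | (k : ℝ) ≤ f x} := by
        rw [lintegral_tsum fun k => aemeasurable_const.indicator₀ (hnull k)]
        congr 1 with k
        rw [lintegral_indicator_const₀ (hnull k)]
    _ ≤ ∑' k : ℕ, ENNReal.ofReal (C * Real.exp 1 * (((k : ℝ) + 1) * Real.exp (-ε) ^ (k + 1))) := by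
        refine ENNReal.tsum_le_tsum fun k => ?_
        rw [← hterm, ENNReal.ofReal_mul (Real.exp_pos _).le]
        gcongr
        exact hμ k (Nat.cast_nonneg k)
    _ = ENNReal.ofReal (C * Real.exp 1 * (Real.exp (-ε) / (1 - Real.exp (-ε)) ^ 2)) := by
        rw [← ENNReal.ofReal_tsum_of_nonneg (fun k => by positivity) hsum.summable, hsum.tsum_eq]
    _ ≤ _ := by
        refine ENNReal.ofReal_le_ofReal ?_
        exact mul_le_mul_of_nonneg_left (exp_neg_div_one_sub_sq_le hε hε') (by positivity)

lemma integrable_and_integral_le_of_lintegral_le {α : Type*} [MeasurableSpace α] {μ : Measure α}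
    {f : α → ℝ} (hf : AEStronglyMeasurable f μ) (hf0 : ∀ x, 0 ≤ f x) {C : ℝ} (hC : 0 ≤ C)
    (h : ∫⁻ x, ENNReal.ofReal (f x) ∂μ ≤ ENNReal.ofReal C) :
    Integrable f μ ∧ ∫ x, f x ∂μ ≤ C := by
  refine ⟨(lintegral_ofReal_ne_top_iff_integrable hf (ae_of_all _ hf0)).1
    (h.trans_lt ENNReal.ofReal_lt_top).ne, ?_⟩
  rw [integral_eq_lintegral_of_nonneg_ae (ae_of_all _ hf0) hf]
  exact ENNReal.toReal_le_of_le_ofReal hC h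

/-- Jensen's inequality for powers of an exponential, in normalised form. -/
lemma integral_exp_mul_le {α : Type*} [MeasurableSpace α] {μ : Measure α} [IsFiniteMeasure μ]
    (hμ : 0 < μ.real Set.univ) {f : α → ℝ} (hf : AEMeasurable f μ)
    (hint : Integrable (fun x => Real.exp (f x)) μ) {M : ℝ}
    (hM : 1 / μ.real Set.univ * ∫ x, Real.exp (f x) ∂μ ≤ Real.exp M)
    {θ : ℝ} (h0 : 0 ≤ θ) (h1 : θ ≤ 1) :
    Integrable (fun x => Real.exp (θ * f x)) μ ∧
      1 / μ.real Set.univ * ∫ x, Real.exp (θ * f x) ∂μ ≤ Real.exp (θ * M) := by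
  -- Convexity of `exp` between `0` and `f x - M`, used pointwise, yields integrability as well as
  -- the bound.
  have hpt : ∀ x, Real.exp (θ * f x) ≤
      Real.exp (θ * M) * (1 - θ) + Real.exp (θ * M) * θ * Real.exp (-M) * Real.exp (f x) := by
    intro x
    have h := convexOn_exp.2 (Set.mem_univ 0) (Set.mem_univ (f x - M))
      (sub_nonneg.2 h1) h0 (sub_add_cancel 1 θ)
    simp only [smul_eq_mul, mul_zero, zero_add, Real.exp_zero, mul_one] at h
    calc Real.exp (θ * f x) = Real.exp (θ * M) * Real.exp (θ * (f x - M)) := by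
          rw [← Real.exp_add]; congr 1; ring
      _ ≤ Real.exp (θ * M) * (1 - θ + θ * Real.exp (f x - M)) := by gcongr
      _ = _ := by
          rw [sub_eq_add_neg (f x), Real.exp_add]
          ring
  have hmaj : Integrable (fun x => Real.exp (θ * M) * (1 - θ) +
      Real.exp (θ * M) * θ * Real.exp (-M) * Real.exp (f x)) μ :=
    (integrable_const _).add (hint.const_mul _)
  have hi : Integrable (fun x => Real.exp (θ * f x)) μ :=
    hmaj.mono' (Real.measurable_exp.comp_aemeasurable (hf.const_mul θ)).aestronglyMeasurable
      (ae_of_all _ fun x => by simpa using hpt x)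
  refine ⟨hi, ?_⟩
  have h2 := integral_mono hi hmaj hpt
  rw [integral_add (integrable_const _) (hint.const_mul _), integral_const, integral_const_mul,
    smul_eq_mul] at h2
  set v := μ.real Set.univ
  set J := ∫ x, Real.exp (f x) ∂μ
  have hMM : Real.exp (-M) * Real.exp M = 1 := by rw [← Real.exp_add]; simp
  calc 1 / v * ∫ x, Real.exp (θ * f x) ∂μ
      ≤ 1 / v * (v * (Real.exp (θ * M) * (1 - θ)) +
          Real.exp (θ * M) * θ * Real.exp (-M) * J) := by gcongr
    _ = Real.exp (θ * M) * (1 - θ) + Real.exp (θ * M) * θ * Real.exp (-M) * (1 / v * J) := by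
        field_simp
    _ ≤ Real.exp (θ * M) * (1 - θ) + Real.exp (θ * M) * θ * Real.exp (-M) * Real.exp M := by
        gcongr
    _ = Real.exp (θ * M) := by linear_combination Real.exp (θ * M) * θ * hMM

/-- Clearing denominators leaves `9L ≤ (10L - 14) log L`, which is nearly sharp at `L = 4`. -/
lemma eight_add_log_div_le {L : ℝ} (hL : 4 ≤ L) :
    (8 + 4 * Real.log L + L) / (L - 1) ≤ 1 + 14 * Real.log L / L := by
  have hl : 1.3862 ≤ Real.log L := by
    have h4 : Real.log 4 = 2 * Real.log 2 := by
      rw [← Real.log_rpow (by norm_num)]; norm_num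
    have := Real.log_le_log (by norm_num) hL
    have := Real.log_two_gt_d9
    linarith
  have h : 1 + 14 * Real.log L / L = (L + 14 * Real.log L) / L := by field_simp
  rw [h, div_le_div_iff₀ (by linarith) (by linarith)]
  nlinarith [mul_le_mul_of_nonneg_right hl (by linarith : 0 ≤ 10 * L - 14)]

lemma volume_real_pos_of_integral_ne_zero {Ω : Set Plane} (hfin : volume Ω ≠ ⊤) {f : Plane → ℂ}
    (h : ∫ x in Ω, f x ≠ 0) : 0 < volume.real Ω := by
  refine ENNReal.toReal_pos (fun h0 => h ?_) hfin
  rw [Measure.restrict_eq_zero.2 h0, integral_zero_measure]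

/-- Subcritical exponential integrability of the density. -/
theorem integral_exp_density_le {Ω : Set Plane} (hΩ : IsOpen Ω) (hfin : volume Ω ≠ ⊤)
    (hpos : 0 < volume.real Ω) {N : ℕ} (hN : 1 ≤ N)
    {u : Fin N → Plane → ℂ} (hu : ∀ n, MemH01 Ω (u n))
    {g : Fin N → Plane → CVec} (hg : ∀ n, IsWeakGradient Ω (u n) (g n))
    (horth : ∀ n m, ∫ x in Ω, inner ℂ (g n x) (g m x) = if m = n then 1 else 0)
    {ε : ℝ} (hε : 0 < ε) (hε' : ε ≤ 1 / 4) :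
    IntegrableOn (fun x => Real.exp (4 * Real.pi * (1 - ε) * density u x)) Ω ∧
      1 / volume.real Ω * ∫ x in Ω, Real.exp (4 * Real.pi * (1 - ε) * density u x)
        ≤ Real.exp 8 / ε ^ 4 * N := by
  have hg2 : ∀ n, MemLp (g n) 2 (volume.restrict Ω) := by
    intro n
    obtain ⟨-, g', hg', hg'2, -⟩ := hu n
    exact hg'2.ae_eq (hg'.ae_eq hΩ (hg n))
  have hρ : AEMeasurable (density u) (volume.restrict Ω) :=
    aemeasurable_density fun n => (hu n).1.1
  have hlint := lintegral_exp_le_of_measure_ge_le (f := fun x => 4 * Real.pi * density u x)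
    (hρ.const_mul _) (fun x => mul_nonneg (by positivity) (density_nonneg u x))
    (C := 500 * N * volume.real Ω) (by positivity)
    (fun a ha => measure_density_ge_le hΩ hfin hpos hN hu hg hg2 horth ha) hε hε'
  have hform : ∀ x, (1 - ε) * (4 * Real.pi * density u x)
      = 4 * Real.pi * (1 - ε) * density u x := fun x => by ring
  simp_rw [hform] at hlint
  obtain ⟨h1, h2⟩ := integrable_and_integral_le_of_lintegral_le
    (f := fun x => Real.exp (4 * Real.pi * (1 - ε) * density u x))
    (Real.measurable_exp.comp_aemeasurable (hρ.const_mul _)).aestronglyMeasurable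
    (fun x => (Real.exp_pos _).le) (by positivity) hlint
  refine ⟨h1, ?_⟩
  have he : Real.exp 1 ≤ 3 := by linarith [Real.exp_one_lt_d9]
  have he8 : (2 : ℝ) ^ 8 ≤ Real.exp 8 := by
    have : Real.exp 8 = Real.exp 1 ^ 8 := by rw [← Real.exp_nat_mul]; norm_num
    rw [this]
    exact pow_le_pow_left₀ (by norm_num) (by linarith [Real.exp_one_gt_d9]) 8
  calc 1 / volume.real Ω * ∫ x in Ω, Real.exp (4 * Real.pi * (1 - ε) * density u x)
      ≤ 1 / volume.real Ω * (500 * N * volume.real Ω * Real.exp 1 * (2 / ε ^ 2)) := by gcongr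
    _ = 1000 * Real.exp 1 / ε ^ 2 * N := by field_simp; ring
    -- Two powers of `ε` are given away: `1000 e ε² ≤ 3000/16 < 2⁸ ≤ e⁸`.
    _ ≤ Real.exp 8 / ε ^ 4 * N := by
      gcongr ?_ * _
      rw [div_le_div_iff₀ (by positivity) (by positivity)]
      have h16 : ε ^ 2 ≤ 1 / 16 := by nlinarith
      have : 1000 * Real.exp 1 * ε ^ 2 ≤ 1000 * 3 * (1 / 16) := by gcongr
      nlinarith [sq_nonneg ε]


end

theorem theorem1p1 (Ω : Set Plane) (hΩ_open : IsOpen Ω) (hΩ_bdd : Bornology.IsBounded Ω)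
    (N : ℕ) (hN : 1 ≤ N)
    (u : Fin N → Plane → ℂ) (hu : ∀ n, MemH01 Ω (u n))
    (Du : Fin N → Plane → CVec) (hDu : ∀ n, IsWeakGradient Ω (u n) (Du n))
    (horth : ∀ n m, ∫ x in Ω, inner ℂ (Du n x) (Du m x) = if m = n then 1 else 0) :
    (∀ ε : ℝ, 0 < ε → ε ≤ 1 / 4 →
      IntegrableOn (fun x => Real.exp (4 * Real.pi * (1 - ε) * density u x)) Ω ∧
      1 / volume.real Ω * ∫ x in Ω, Real.exp (4 * Real.pi * (1 - ε) * density u x)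
        ≤ Real.exp 8 / ε ^ 4 * N) ∧
    (∀ α : ℝ, 0 < α → max (Real.exp 4) (Real.exp (α / (4 * Real.pi) + 1)) ≤ (N : ℝ) →
      IntegrableOn (fun x => Real.exp (α * (density u x / Real.log N))) Ω ∧
      1 / volume.real Ω * ∫ x in Ω, Real.exp (α * (density u x / Real.log N))
        ≤ Real.exp (α / (4 * Real.pi) *
            (1 + 14 * Real.log (Real.log N) / Real.log N))) := by
  have hfin : volume Ω ≠ ⊤ := hΩ_bdd.measure_lt_top.ne
  -- On a null set the normalisation of the first gradient would read `0 = 1`.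
  have hpos : 0 < volume.real Ω := by
    refine volume_real_pos_of_integral_ne_zero hfin
      (f := fun x => inner ℂ (Du ⟨0, hN⟩ x) (Du ⟨0, hN⟩ x)) ?_
    rw [horth]
    simp
  refine ⟨fun ε hε hε' => integral_exp_density_le hΩ_open hfin hpos hN hu hDu horth hε hε',
    fun α hα hNα => ?_⟩
  have hpi := Real.pi_pos
  have hN0 : (0 : ℝ) < N := by exact_mod_cast hN
  set L := Real.log N
  have hexpL : Real.exp L = N := Real.exp_log hN0
  have hL4 : 4 ≤ L := (Real.le_log_iff_exp_le hN0).2 ((le_max_left _ _).trans hNα)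
  have hLα : α / (4 * Real.pi) + 1 ≤ L :=
    (Real.le_log_iff_exp_le hN0).2 ((le_max_right _ _).trans hNα)
  have hL0 : 0 < L := by linarith
  have hL1 : 0 < L - 1 := by linarith
  -- `N ≥ e⁴` gives `1/L ≤ 1/4`. The exponent is then `4π(L - 1)/L · ρ`, and Jensen with `θ =
  -- α/(4π(L - 1))` turns it into `αρ/L`; the other lower bound on `N` is `θ ≤ 1`.
  obtain ⟨hint, hle⟩ := integral_exp_density_le hΩ_open hfin hpos hN hu hDu horth (ε := 1 / L)
    (by positivity) (one_div_le_one_div_of_le (by norm_num) hL4)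
  have : IsFiniteMeasure (volume.restrict Ω) := ⟨by simpa using hfin.lt_top⟩
  have hM : Real.exp 8 / (1 / L) ^ 4 * N = Real.exp (8 + 4 * Real.log L + L) := by
    rw [Real.exp_add, Real.exp_add, hexpL, mul_comm 4, Real.exp_mul, Real.exp_log hL0]
    norm_num
  rw [hM] at hle
  have hθ1 : α / (4 * Real.pi) / (L - 1) ≤ 1 := by
    rw [div_le_one hL1]
    linarith
  have hρ : AEMeasurable (density u) (volume.restrict Ω) :=
    aemeasurable_density fun n => (hu n).1.1
  have key := integral_exp_mul_le (μ := volume.restrict Ω) (by simpa using hpos)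
    (hρ.const_mul _) hint (by simpa using hle) (θ := α / (4 * Real.pi) / (L - 1))
    (by positivity) hθ1
  have hform : ∀ x, α / (4 * Real.pi) / (L - 1) * (4 * Real.pi * (1 - 1 / L) * density u x)
      = α * (density u x / L) := by
    intro x
    field_simp
  simp_rw [hform] at key
  rw [measureReal_restrict_apply_univ] at key
  refine ⟨key.1, key.2.trans (Real.exp_le_exp.2 ?_)⟩
  rw [div_mul_eq_mul_div, mul_div_assoc]
  exact mul_le_mul_of_nonneg_left (eight_add_log_div_le hL4) (by positivity)
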